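/- **Conventions.** An *$n$-premaniplex* is a connected graph (semi-edges and parallel edges allowed) with edges coloured by $0,\dots,n-1$ such that every vertex (called a *flag*) is incident to exactly one edge of each colour and, whenever $|i-j|>1$, the alternating paths of length 4 with colours $i,j$ are closed. Write $r_i$ for the permutation sending each flag $\Phi$ to the other end $\Phi^i$ of its edge of colour $i$. An *$n$-maniplex* is a finite $n$-premaniplex whose graph is simple. An *(abstract) $n$-polytope* is an $n$-maniplex such that, whenever two flags are joined by a path with colours in $[0,m]$ and by a path with colours in $[k,n-1]$, they are joined by a path with colours in $[k,m]$; a *polyhedron* is a 3-polytope. The *$i$-faces* are the connected components left after deleting the edges of colour $i$; 0-faces are *vertices*, $(n-1)$-faces are *facets*. Isomorphisms preserve colours; $\Gamma(\mathcal P)$ is the automorphism group, acting on the right. $\mathcal P$ is *regular* if $\Gamma(\mathcal P)$ is transitive on flags; *self-dual* if it is isomorphic to the maniplex obtained by replacing each colour $i$ by $n-1-i$; *degenerate* if $(r_ir_{i+1})^2$ fixes some flag for some $0\le i\le n-2$. A *Petrie polygon* is an orbit of flags under the permutation $r_{n-1}\cdots r_1r_0$ ($r_0$ being applied first); it is *simple*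 if any two different flags in it have different vertices. The *symmetry type graph* of a maniplex has the flag orbits under the automorphism group as its vertices, with an edge of colour $i$ from the orbit of $\Phi$ to the orbit of $\Phi^i$ (a semi-edge if they coincide). A *voltage assignment* on the darts (directed edges) of a premaniplex $\mathcal X$ with values in a group $\Gamma$ satisfies $\xi(d^{-1})=\xi(d)^{-1}$; the voltage of a path $d_1d_2\cdots d_k$ is $\xi(d_k)\cdots\xi(d_2)\xi(d_1)$. The *derived graph* $\mathcal X^\xi$ has vertex set $V(\mathcal X)\times\Gamma$, with a dart from $(x,\gamma)$ to $(y,\xi(d)\gamma)$, of the same colour as $d$, for each dart $d$ from $x$ to $y$ and each $\gamma\in\Gamma$. The triple $(\mathcal X,\Gamma,\xi)$ is a *voltage premaniplex* if there is a spanning tree with trivial voltages such that the voltages of the remaining darts generate $\Gamma$, every semi-edge has voltage of order 2, different parallel darts have different voltages, and the alternating paths of length 4 with colours $i,j$, $|i-j|>1$, have trivial voltage. The *premaniplex of family 1 with $n$ sides* is the $n$-gon, that is, the cycle with $2n$ flags and edges coloured alternately 0 and 1, together with an edge of colour 2 joining every pair of 0-adjacent flags. **Theorem.** Let $\mathcal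 P$ be a regular $n$-polytope that is non-degenerate, is not self-dual, and has simple Petrie polygons. Fix a base flag $\Phi$ of $\mathcal P$, and for $0\le i\le n-1$ let $\rho_i$ be the automorphism of $\mathcal P$ mapping $\Phi$ to $\Phi^i$. Let $\mathcal X$ be the premaniplex of family 1 with $n$ sides, number the edges (1-faces) of its $n$-gon cyclically by $0,\dots,n-1$, and let $\xi$ be the voltage assignment on $\mathcal X$ with values in $\Gamma(\mathcal P)$ that gives voltage $\rho_i$ to the two darts of colour 2 starting at the $i$-th edge and trivial voltage to all darts of colours 0 and 1. Then $(\mathcal X,\Gamma(\mathcal P),\xi)$ is a voltage premaniplex, and $\mathcal X^\xi$ is a polyhedron whose symmetry type graph is isomorphic to $\mathcal X$. In particular, $\mathcal X^\xi$ is vertex-transitive and facet-transitive, the stabilizer of each facet in its automorphism group is trivial, and $\mathcal X^\xi$ has exactly $2n$ flag orbits. -/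

import Mathlib

universe u v

/-- A graph with a colouring of its edges by `0, …, n-1` in which every vertex is incident to
exactly one edge of each colour. Semi-edges (`adj i x = x`) and parallel edges of different
colours (`adj i x = adj j x`) are allowed. The vertices are called flags, and `adj i x` is the
other end of the edge of colour `i` at `x`, i.e. the `i`-adjacent flag of `x`. -/
structure ColoredGraph (n : ℕ) where
  Flag : Type u
  adj : Fin n → Flag → Flag
  adj_adj : ∀ i x, adj i (adj i x) = x

namespace ColoredGraph

variable {n : ℕ}

/-! ### Darts and paths -/

/-- A dart is determined by its initial vertex and its colour. -/
abbrev Dart (M : ColoredGraph.{u} n) : Type u := M.Flag × Fin n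

/-- The initial vertex of a dart. -/
def Dart.init {M : ColoredGraph.{u} n} (d : M.Dart) : M.Flag := d.1

/-- The final vertex of a dart. -/
def Dart.final {M : ColoredGraph.{u} n} (d : M.Dart) : M.Flag := M.adj d.2 d.1

/-- The inverse dart. -/
def Dart.inv {M : ColoredGraph.{u} n} (d : M.Dart) : M.Dart := (M.adj d.2 d.1, d.2)

/-- There is a path from `x` to `y` that only uses colours in `S`. -/
def Joined (M : ColoredGraph.{u} n) (S : Set (Fin n)) : M.Flag → M.Flag → Prop :=
  Relation.ReflTransGen fun x y => ∃ i ∈ S, y = M.adj i x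

def IsConnected (M : ColoredGraph.{u} n) : Prop :=
  Nonempty M.Flag ∧ ∀ x y, M.Joined Set.univ x y

/-! ### Premaniplexes, maniplexes, polytopes -/

/-- A connected graph in which the alternating paths of length four with two colours `i`, `j`
such that `|i - j| > 1` are closed. -/
def IsPremaniplex (M : ColoredGraph.{u} n) : Prop :=
  M.IsConnected ∧
    ∀ i j : Fin n, 1 < |(i : ℤ) - (j : ℤ)| → ∀ x, M.adj j (M.adj i (M.adj j (M.adj i x))) = x

/-- A finite premaniplex whose graph is simple (no semi-edges, no parallel edges). -/
def IsManiplex (M : ColoredGraph.{u} n) : Prop :=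
  M.IsPremaniplex ∧ Finite M.Flag ∧ (∀ i x, M.adj i x ≠ x) ∧
    ∀ i j x, i ≠ j → M.adj i x ≠ M.adj j x

/-- An abstract `n`-polytope: an `n`-maniplex with the path intersection property. -/
def IsPolytope (M : ColoredGraph.{u} n) : Prop :=
  M.IsManiplex ∧ ∀ (x y : M.Flag) (k m : Fin n),
    M.Joined {i | i ≤ m} x y → M.Joined {i | k ≤ i} x y → M.Joined {i | k ≤ i ∧ i ≤ m} x y

/-- The `i`-face containing the flag `x`: the component of `x` after the removal of the edges of
colour `i`, given by its set of flags. -/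
def face (M : ColoredGraph.{u} n) (i : ℕ) (x : M.Flag) : Set M.Flag :=
  {y | M.Joined {j | (j : ℕ) ≠ i} x y}

/-- The set of all `i`-faces. -/
def faces (M : ColoredGraph.{u} n) (i : ℕ) : Set (Set M.Flag) := Set.range (M.face i)

/-! ### Isomorphisms and automorphisms -/

/-- A colour-preserving isomorphism. -/
@[ext]
structure Iso (M : ColoredGraph.{u} n) (N : ColoredGraph.{v} n) where
  toEquiv : M.Flag ≃ N.Flag
  map_adj : ∀ i x, toEquiv (M.adj i x) = N.adj i (toEquiv x)

/-- The automorphism group. -/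
abbrev Aut (M : ColoredGraph.{u} n) : Type u := Iso M M

/-- Automorphisms act on the right: in the product `f * g`, the automorphism `f` is applied
first. -/
instance (M : ColoredGraph.{u} n) : Group M.Aut where
  mul f g := ⟨f.toEquiv.trans g.toEquiv, fun i x => by simp [f.map_adj, g.map_adj]⟩
  one := ⟨Equiv.refl _, fun _ _ => rfl⟩
  inv f := ⟨f.toEquiv.symm, fun i x => by
    rw [Equiv.symm_apply_eq, f.map_adj, Equiv.apply_symm_apply]⟩
  mul_assoc _ _ _ := rfl
  one_mul _ := rfl
  mul_one _ := rfl
  inv_mul_cancel f := Iso.ext (Equiv.symm_trans_self f.toEquiv)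

theorem Aut.mul_apply {M : ColoredGraph.{u} n} (f g : M.Aut) (x : M.Flag) :
    (f * g).toEquiv x = g.toEquiv (f.toEquiv x) := rfl

theorem Aut.one_apply {M : ColoredGraph.{u} n} (x : M.Flag) :
    (1 : M.Aut).toEquiv x = x := rfl

/-- Automorphisms of a connected graph act freely on its flags. -/
theorem Aut.ext_of_apply_eq {M : ColoredGraph.{u} n} (hM : M.IsConnected) {f g : M.Aut}
    {x : M.Flag} (h : f.toEquiv x = g.toEquiv x) : f = g := by
  apply Iso.ext
  ext y
  have hxy := hM.2 x y
  unfold Joined at hxy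
  induction hxy with
  | refl => exact h
  | tail _ hs ih =>
    obtain ⟨i, -, rfl⟩ := hs
    rw [f.map_adj, g.map_adj, ih]

/-- The automorphism group is transitive on the flags. -/
def IsRegular (M : ColoredGraph.{u} n) : Prop :=
  ∀ x y : M.Flag, ∃ f : M.Aut, f.toEquiv x = y

/-- The automorphism group is transitive on the `i`-faces. -/
def IsFaceTransitive (M : ColoredGraph.{u} n) (i : ℕ) : Prop :=
  ∀ F ∈ M.faces i, ∀ G ∈ M.faces i, ∃ f : M.Aut, f.toEquiv '' F = G

/-- The stabilizer of every facet in the automorphism group is trivial. -/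
def HasTrivialFacetStabilizers (M : ColoredGraph.{u} n) : Prop :=
  ∀ F ∈ M.faces (n - 1), ∀ f : M.Aut, f.toEquiv '' F = F → f = 1

/-- The dual: colour `i` becomes colour `n-1-i`. -/
def dual (M : ColoredGraph.{u} n) : ColoredGraph.{u} n where
  Flag := M.Flag
  adj i := M.adj i.rev
  adj_adj i := M.adj_adj i.rev

def IsSelfDual (M : ColoredGraph.{u} n) : Prop := Nonempty (Iso M.dual M)

/-! ### Monodromies, degeneracy, Petrie polygons -/

/-- The flag permutation `r_i`, mapping each flag to its `i`-adjacent flag. Monodromies act on the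
left: in a product of permutations the right-most factor is applied first. -/
def mon (M : ColoredGraph.{u} n) (i : Fin n) : Equiv.Perm M.Flag where
  toFun := M.adj i
  invFun := M.adj i
  left_inv := M.adj_adj i
  right_inv := M.adj_adj i

/-- For some `i`, the monodromy `(r_i r_{i+1})²` fixes some flag. -/
def IsDegenerate (M : ColoredGraph.{u} n) : Prop :=
  ∃ i j : Fin n, (j : ℕ) = i + 1 ∧ ∃ x, ((M.mon i * M.mon j) ^ 2) x = x

/-- The monodromy `r_{n-1} ⋯ r_1 r_0`. -/
def petrieMon (M : ColoredGraph.{u} n) : Equiv.Perm M.Flag :=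
  ((List.finRange n).reverse.map M.mon).prod

/-- The Petrie polygon containing `x`: the orbit of `x` under `r_{n-1} ⋯ r_1 r_0`. -/
def petriePolygon (M : ColoredGraph.{u} n) (x : M.Flag) : Set M.Flag :=
  MulAction.orbit (Subgroup.zpowers M.petrieMon) x

/-- In every Petrie polygon, different flags have different vertices (0-faces). -/
def HasSimplePetriePolygons (M : ColoredGraph.{u} n) : Prop :=
  ∀ x, Set.InjOn (M.face 0) (M.petriePolygon x)

/-! ### Distinguished generators of a regular polytope -/

/-- The automorphism `ρ_i` mapping the base flag `Φ` to its `i`-adjacent flag. -/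
noncomputable def rho (M : ColoredGraph.{u} n) (h : M.IsRegular) (Φ : M.Flag) (i : Fin n) :
    M.Aut :=
  Classical.choose (h Φ (M.adj i Φ))

theorem rho_apply (M : ColoredGraph.{u} n) (h : M.IsRegular) (Φ : M.Flag) (i : Fin n) :
    (M.rho h Φ i).toEquiv Φ = M.adj i Φ :=
  Classical.choose_spec (h Φ (M.adj i Φ))

theorem rho_mul_self (M : ColoredGraph.{u} n) (hM : M.IsConnected) (h : M.IsRegular)
    (Φ : M.Flag) (i : Fin n) : M.rho h Φ i * M.rho h Φ i = 1 := by
  apply Aut.ext_of_apply_eq hM (x := Φ)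
  rw [Aut.mul_apply, Aut.one_apply, rho_apply, Iso.map_adj, rho_apply, M.adj_adj]

/-! ### Symmetry type graph -/

/-- Two flags are in the same orbit of the automorphism group. -/
def orbitSetoid (M : ColoredGraph.{u} n) : Setoid M.Flag where
  r x y := ∃ f : M.Aut, f.toEquiv x = y
  iseqv :=
    { refl := fun _ => ⟨1, rfl⟩
      symm := by
        rintro x _ ⟨f, rfl⟩
        exact ⟨f⁻¹, f.toEquiv.symm_apply_apply x⟩
      trans := by
        rintro x _ _ ⟨f, rfl⟩ ⟨g, rfl⟩
        exact ⟨f * g, rfl⟩ }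

/-- The set of flag orbits. -/
abbrev FlagOrbit (M : ColoredGraph.{u} n) : Type u := Quotient M.orbitSetoid

/-- The symmetry type graph: its vertices are the flag orbits, and the edge of colour `i` at the
orbit of `x` leads to the orbit of the `i`-adjacent flag of `x`. -/
def symmetryTypeGraph (M : ColoredGraph.{u} n) : ColoredGraph.{u} n where
  Flag := M.FlagOrbit
  adj i := Quotient.map (M.adj i) (by
    rintro x _ ⟨f, rfl⟩
    exact ⟨f, f.map_adj i x⟩)
  adj_adj i := by
    rintro ⟨x⟩
    exact congrArg (Quotient.mk M.orbitSetoid) (M.adj_adj i x)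

/-! ### Voltage graphs -/

/-- A voltage assignment on the darts of `X` with values in the group `G`. -/
structure Voltage (X : ColoredGraph.{u} n) (G : Type v) [Group G] where
  val : X.Dart → G
  val_inv : ∀ d, val d.inv = (val d)⁻¹

/-- The voltage of the path that starts at `x` and follows the given sequence of colours; the
voltage of a path `d₁ d₂ ⋯ d_k` is the product `ξ(d_k) ⋯ ξ(d₂) ξ(d₁)`. -/
def Voltage.path {X : ColoredGraph.{u} n} {G : Type v} [Group G] (ξ : X.Voltage G) :
    X.Flag → List (Fin n) → G
  | _, [] => 1
  | x, i :: l => ξ.path (X.adj i x) l * ξ.val (x, i)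

/-- The derived graph: for every dart `d` from `x` to `y` and every `g` there is a dart from
`(x, g)` to `(y, ξ(d) g)`, of the same colour as `d`. -/
def Voltage.derived {X : ColoredGraph.{u} n} {G : Type v} [Group G] (ξ : X.Voltage G) :
    ColoredGraph.{max u v} n where
  Flag := X.Flag × G
  adj i p := (X.adj i p.1, ξ.val (p.1, i) * p.2)
  adj_adj i p := by
    have h := ξ.val_inv (p.1, i)
    simp only [Dart.inv] at h
    simp [X.adj_adj, h]

/-- A set of darts, closed under inverses, that forms a spanning tree of `X`. -/
def IsSpanningTree (X : ColoredGraph.{u} n) (T : Set X.Dart) : Prop :=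
  (∀ d ∈ T, d.inv ∈ T) ∧
    ∃ H : SimpleGraph X.Flag, H.IsTree ∧ (∀ d ∈ T, H.Adj d.init d.final) ∧
      ∀ x y, H.Adj x y → ∃! d : X.Dart, d ∈ T ∧ d.init = x ∧ d.final = y

/-- Voltage premaniplexes: `X` is a premaniplex; some spanning tree has trivial voltage and the
voltages of the other darts generate the group; semi-edges have voltage of order two; different
parallel darts have different voltages; alternating paths of length four with two colours `i`, `j`
such that `|i - j| > 1` have trivial voltage. -/
def Voltage.IsVoltagePremaniplex {X : ColoredGraph.{u} n} {G : Type v} [Group G]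
    (ξ : X.Voltage G) : Prop :=
  X.IsPremaniplex ∧
    (∃ T : Set X.Dart, X.IsSpanningTree T ∧ (∀ d ∈ T, ξ.val d = 1) ∧
      Subgroup.closure (ξ.val '' Tᶜ) = ⊤) ∧
    (∀ d : X.Dart, d.inv = d → orderOf (ξ.val d) = 2) ∧
    (∀ d e : X.Dart, d ≠ e → d.init = e.init → d.final = e.final → ξ.val d ≠ ξ.val e) ∧
    ∀ i j : Fin n, 1 < |(i : ℤ) - (j : ℤ)| → ∀ x, ξ.path x [i, j, i, j] = 1

/-! ### Family 1 -/

/-- The `n`-gon: flags are pairs of an edge `k` (the edges being numbered cyclically by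
`0, …, n-1`) and one of its two ends. The end `true` of edge `k` and the end `false` of edge
`k + 1` (modulo `n`) are at the same vertex. -/
def polygon (n : ℕ) : ColoredGraph.{0} 2 where
  Flag := Fin n × Bool
  adj := ![fun x => (x.1, !x.2),
    fun x => if x.2 then (finRotate n x.1, false) else ((finRotate n).symm x.1, true)]
  adj_adj i x := by
    obtain ⟨k, b⟩ := x
    fin_cases i <;> cases b <;> simp [-finRotate_apply, -finRotate_symm_apply]

/-- The member of family 1 with `n` sides: the `n`-gon, with an additional edge of colour 2
between any two 0-adjacent flags. -/
def family1 (n : ℕ) : ColoredGraph.{0} 3 where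
  Flag := (polygon n).Flag
  adj := ![(polygon n).adj 0, (polygon n).adj 1, (polygon n).adj 0]
  adj_adj i x := by
    fin_cases i
    · exact (polygon n).adj_adj 0 x
    · exact (polygon n).adj_adj 1 x
    · exact (polygon n).adj_adj 0 x

/-- The voltage assignment on the member of family 1 with `n` sides that assigns `α k` to the
darts of colour 2 starting at the `k`-th edge of the polygon, and is trivial on colours 0, 1. -/
def family1Voltage {n : ℕ} {G : Type v} [Group G] (α : Fin n → G) (hα : ∀ k, α k * α k = 1) :
    (family1 n).Voltage G where
  val d := if d.2 = 2 then α d.1.1 else 1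
  val_inv := by
    rintro ⟨⟨k, b⟩, i⟩
    fin_cases i
    · simp [Dart.inv]
    · simp [Dart.inv]
    · simpa [Dart.inv, family1, polygon] using eq_inv_of_mul_eq_one_left (hα k)

end ColoredGraph

/-! Flags of the derived graph are pairs (c, g) of a polygon flag and an automorphism of P. Since P
is regular, g ↦ gΦ identifies the automorphisms with the flags of P, and g ↦ ρ_i g becomes
i-adjacency (`rho_mul_apply`). Colours 0 and 1 do not change g, so each facet is a copy of the
polygon labelled by one g.

Polytopality: a walk around a vertex uses colours 1 and 2. Along it, gΦ runs through the successive
flags w, r_0 w, r_1 r_0 w, … of a Petrie polygon of P, in step with the vertices of the n-gon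
(`exists_mem_petriePolygon_of_joined`). Because Petrie polygons are simple, initial segments of
different lengths only meet when the lengths agree modulo n
(`IsPolytope.mod_eq_of_petriePrefix_eq`). Hence a vertex meets a facet in at most two flags, which
are 1-adjacent (`eq_or_eq_adj_one_of_joined`). In rank 3 this yields the path intersection property.

Symmetry type: right multiplications are transitive on each fibre of (c, g) ↦ c, so it remains to
see that no automorphism moves a fibre (`derived_family1_aut_apply_fst`). An automorphism acts on
all facets by one symmetry δ of the n-gon and sends label g to t(g), with t(ρ_k g) = ρ_{δ(k)} t(g).
If δ reverses the edge numbers, t gives a duality of P. If δ is neither that reversal nor the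
identity, it sends edges 0 and n-1 to edges with consecutive numbers, and the commutation of ρ_0 and
ρ_{n-1} makes P degenerate. Rank at least 3, needed for that commutation, follows from the
hypotheses (`IsPolytope.three_le`). -/

namespace SimpleGraph

/-- A connected graph whose vertices can be numbered injectively in such a way that adjacent
vertices have consecutive numbers is a tree. -/
theorem Connected.isTree_of_consecutive {V : Type u} {H : SimpleGraph V} (hc : H.Connected)
    (f : V → ℕ) (hf : Function.Injective f)
    (h : ∀ x y, H.Adj x y → f y = f x + 1 ∨ f x = f y + 1) : H.IsTree := by
  refine ⟨hc, isAcyclic_iff_forall_adj_isBridge.2 ?_⟩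
  have key : ∀ x y, f y = f x + 1 → ¬ (H.deleteEdges {s(x, y)}).Reachable x y := by
    intro x y hxy hr
    rw [reachable_iff_reflTransGen] at hr
    -- Without the edge xy, no walk from x can pass from number f x to f x + 1: by injectivity, that
    -- step would be xy itself.
    have : ∀ z, Relation.ReflTransGen (H.deleteEdges {s(x, y)}).Adj x z → f z ≤ f x := by
      intro z hz
      induction hz with
      | refl => exact le_rfl
      | @tail a b _ hab ih =>
        rw [deleteEdges_adj] at hab
        by_contra hcon
        have h1 := h _ _ hab.1
        have ha : a = x := hf (by omega)
        have hb : b = y := hf (by omega)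
        exact hab.2 (by simp [ha, hb])
    have := this y hr
    omega
  intro x y hxy
  rw [isBridge_iff]
  rcases h x y hxy with h1 | h1
  · exact key x y h1
  · intro hr
    rw [Sym2.eq_swap] at hr
    exact key y x h1 hr.symm

end SimpleGraph

/-! ### Cyclic rotation of edge numbers -/

theorem val_finRotate {n : ℕ} (k : Fin n) :
    (finRotate n k : ℕ) = if (k : ℕ) + 1 = n then 0 else (k : ℕ) + 1 := by
  obtain _ | n := n
  · exact k.elim0
  rw [coe_finRotate]
  simp [Fin.ext_iff]

theorem finRotate_mk_of_lt {n k : ℕ} (hk : k + 1 < n) :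
    finRotate n ⟨k, by omega⟩ = ⟨k + 1, hk⟩ := by
  rw [Fin.ext_iff, val_finRotate]
  exact if_neg (by simp; omega)

theorem val_finRotate_symm {n : ℕ} (k : Fin n) :
    ((finRotate n).symm k : ℕ) = if (k : ℕ) = 0 then n - 1 else (k : ℕ) - 1 := by
  have h := val_finRotate ((finRotate n).symm k)
  rw [Equiv.apply_symm_apply] at h
  have := ((finRotate n).symm k).2
  split_ifs at h ⊢ <;> omega

namespace ColoredGraph

variable {n : ℕ}

/-! ### Paths, faces and isomorphisms -/

theorem Joined.symm {M : ColoredGraph.{u} n} {S : Set (Fin n)} {x y : M.Flag}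
    (h : M.Joined S x y) : M.Joined S y x := by
  unfold Joined at h
  induction h with
  | refl => exact Relation.ReflTransGen.refl
  | tail _ hs ih =>
    obtain ⟨i, hi, rfl⟩ := hs
    exact Relation.ReflTransGen.head ⟨i, hi, (M.adj_adj i _).symm⟩ ih

theorem Joined.adj {M : ColoredGraph.{u} n} {S : Set (Fin n)} {x y : M.Flag}
    (h : M.Joined S x y) {i : Fin n} (hi : i ∈ S) : M.Joined S x (M.adj i y) :=
  Relation.ReflTransGen.tail h ⟨i, hi, rfl⟩

theorem joined_adj (M : ColoredGraph.{u} n) {S : Set (Fin n)} {i : Fin n} (hi : i ∈ S)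
    (x : M.Flag) : M.Joined S x (M.adj i x) :=
  Relation.ReflTransGen.single ⟨i, hi, rfl⟩

theorem Joined.tail {M : ColoredGraph.{u} n} {S : Set (Fin n)} {x y z : M.Flag}
    (h : M.Joined S x y) {i : Fin n} (hi : i ∈ S) (e : M.adj i y = z) : M.Joined S x z :=
  e ▸ h.adj hi

theorem Joined.trans {M : ColoredGraph.{u} n} {S : Set (Fin n)} {x y z : M.Flag}
    (h : M.Joined S x y) (h' : M.Joined S y z) : M.Joined S x z :=
  Relation.ReflTransGen.trans h h'

theorem Joined.mono {M : ColoredGraph.{u} n} {S T : Set (Fin n)} (hST : S ⊆ T) {x y : M.Flag}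
    (h : M.Joined S x y) : M.Joined T x y :=
  Relation.ReflTransGen.mono (fun _ _ ⟨i, hi, e⟩ => ⟨i, hST hi, e⟩) _ _ h

/-- A property invariant under the adjacencies with colours in `S` is constant along paths with
colours in `S`. -/
theorem Joined.induction {M : ColoredGraph.{u} n} {S : Set (Fin n)} {p : M.Flag → Prop}
    {x y : M.Flag} (h : M.Joined S x y) (hx : p x) (hp : ∀ i ∈ S, ∀ z, p z → p (M.adj i z)) :
    p y := by
  unfold Joined at h
  induction h with
  | refl => exact hx
  | tail _ hs ih =>
    obtain ⟨i, hi, rfl⟩ := hs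
    exact hp i hi _ ih

theorem face_eq_of_joined {M : ColoredGraph.{u} n} {i : ℕ} {x y : M.Flag}
    (h : M.Joined {j | (j : ℕ) ≠ i} x y) : M.face i x = M.face i y :=
  Set.ext fun _ => ⟨fun h' => h.symm.trans h', fun h' => h.trans h'⟩

theorem Iso.map_joined {M : ColoredGraph.{u} n} {N : ColoredGraph.{v} n} (f : Iso M N)
    {S : Set (Fin n)} {x y : M.Flag} (h : M.Joined S x y) :
    N.Joined S (f.toEquiv x) (f.toEquiv y) :=
  h.induction (p := fun y => N.Joined S (f.toEquiv x) (f.toEquiv y)) Relation.ReflTransGen.refl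
    fun i hi z hz => by
      rw [f.map_adj]
      exact hz.adj hi

def Iso.symm {M : ColoredGraph.{u} n} {N : ColoredGraph.{v} n} (f : Iso M N) : Iso N M where
  toEquiv := f.toEquiv.symm
  map_adj i x := by rw [Equiv.symm_apply_eq, f.map_adj, Equiv.apply_symm_apply]

theorem Aut.image_face {M : ColoredGraph.{u} n} (f : M.Aut) (i : ℕ) (x : M.Flag) :
    f.toEquiv '' M.face i x = M.face i (f.toEquiv x) := by
  ext y
  constructor
  · rintro ⟨z, hz, rfl⟩
    exact f.map_joined hz
  · intro hy
    refine ⟨f.toEquiv.symm y, ?_, f.toEquiv.apply_symm_apply y⟩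
    have := Iso.map_joined (Iso.symm f) hy
    simp only [Iso.symm, Equiv.symm_apply_apply] at this
    exact this

/-! ### The polygon and the premaniplexes of family 1 -/

theorem family1_adj_zero (k : Fin n) (b : Bool) : (family1 n).adj 0 (k, b) = (k, !b) := rfl

theorem family1_adj_one_true (k : Fin n) :
    (family1 n).adj 1 (k, true) = (finRotate n k, false) := rfl

theorem family1_adj_one_false (k : Fin n) :
    (family1 n).adj 1 (k, false) = ((finRotate n).symm k, true) := rfl

theorem family1_adj_two (k : Fin n) (b : Bool) : (family1 n).adj 2 (k, b) = (k, !b) := rfl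

/-- Every flag of a member of family 1 is joined to the first one by the edges of the polygon. -/
theorem family1_joined (hn : 0 < n) : ∀ (k : ℕ) (hk : k < n) (b : Bool),
    (family1 n).Joined {i | i ≠ 2} (⟨0, hn⟩, false) (⟨k, hk⟩, b) := by
  have flip : ∀ k : Fin n, (family1 n).Joined {i | i ≠ 2} (⟨0, hn⟩, false) (k, false) →
      ∀ b, (family1 n).Joined {i | i ≠ 2} (⟨0, hn⟩, false) (k, b) := by
    rintro k h (_ | _)
    · exact h
    · exact h.adj (i := 0) (by simp)
  intro k
  induction k with
  | zero => exact fun _ => flip _ Relation.ReflTransGen.refl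
  | succ k ih =>
    intro hk
    refine flip _ ?_
    have h := (ih (by omega) true).adj (i := 1) (by simp)
    rwa [family1_adj_one_true, finRotate_mk_of_lt hk] at h

/-- Colours 0 and 1 already connect the polygon, so a map commuting with both is determined by its
value at one flag. -/
theorem family1_induction {p : (family1 n).Flag → Prop} {c : (family1 n).Flag} (hc : p c)
    (h0 : ∀ x, p x → p ((family1 n).adj 0 x)) (h1 : ∀ x, p x → p ((family1 n).adj 1 x)) :
    ∀ x, p x := by
  have hn : 0 < n := c.1.pos
  intro x
  refine Joined.induction (S := {i | i ≠ 2}) (x := c) (y := x) ?_ hc ?_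
  · exact (family1_joined hn c.1 c.1.2 c.2).symm.trans (family1_joined hn x.1 x.1.2 x.2)
  · intro i hi z hz
    fin_cases i
    · exact h0 z hz
    · exact h1 z hz
    · exact absurd rfl hi

theorem family1_isPremaniplex (hn : 0 < n) : (family1 n).IsPremaniplex := by
  refine ⟨⟨⟨(⟨0, hn⟩, false)⟩, fun x y => ?_⟩, ?_⟩
  · refine Joined.mono (Set.subset_univ _)
      ((family1_joined hn x.1 x.1.2 x.2).symm.trans (family1_joined hn y.1 y.1.2 y.2))
  · rintro i j hij ⟨k, b⟩
    fin_cases i <;> fin_cases j <;> simp at hij <;>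
      simp [family1_adj_zero, family1_adj_two] <;> rfl

/-- The darts of the spanning path of the polygon that starts at the end `false` of edge `0`. -/
def family1Tree (n : ℕ) : Set (family1 n).Dart :=
  {d | d.2 ≠ 2 ∧ ¬ (d.2 = 1 ∧ (d.1.1 : ℕ) = 0 ∧ d.1.2 = false) ∧
    ¬ (d.2 = 1 ∧ (d.1.1 : ℕ) + 1 = n ∧ d.1.2 = true)}

/-- The position of a flag on the spanning path. -/
def family1Index (x : (family1 n).Flag) : ℕ := 2 * (x.1 : ℕ) + x.2.toNat

theorem family1Index_injective : Function.Injective (family1Index (n := n)) := by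
  rintro ⟨⟨k, hk⟩, b⟩ ⟨⟨l, hl⟩, c⟩ h
  cases b <;> cases c <;> simp [family1Index] at h <;> first | omega | (subst h; rfl)

theorem inv_mem_family1Tree {d : (family1 n).Dart} (hd : d ∈ family1Tree n) :
    d.inv ∈ family1Tree n := by
  obtain ⟨⟨k, b⟩, i⟩ := d
  have := k.2
  fin_cases i
  · simp [family1Tree, Dart.inv]
  · cases b <;>
    simp [-finRotate_apply, -finRotate_symm_apply, family1Tree, Dart.inv, family1_adj_one_true,
      family1_adj_one_false, val_finRotate, val_finRotate_symm] at hd ⊢ <;> grind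
  · exact absurd rfl hd.1

theorem index_final_of_mem_family1Tree {d : (family1 n).Dart} (hd : d ∈ family1Tree n) :
    family1Index d.final = family1Index d.init + 1 ∨
      family1Index d.init = family1Index d.final + 1 := by
  obtain ⟨⟨k, b⟩, i⟩ := d
  have := k.2
  fin_cases i
  · cases b <;> simp [Dart.init, Dart.final, family1_adj_zero, family1Index]
  · cases b <;>
    simp [-finRotate_apply, -finRotate_symm_apply, family1Tree, Dart.init, Dart.final,
      family1_adj_one_true, family1_adj_one_false, val_finRotate, val_finRotate_symm,
      family1Index] at hd ⊢ <;> grind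
  · exact absurd rfl hd.1

/-- The adjacencies of colours 0 and 1 never agree on a polygon with at least two sides. -/
theorem family1_adj_zero_ne_adj_one (hn : 2 ≤ n) (x : (family1 n).Flag) :
    (family1 n).adj 0 x ≠ (family1 n).adj 1 x := by
  obtain ⟨k, b⟩ := x
  have := k.2
  intro h
  cases b
  · rw [family1_adj_zero, family1_adj_one_false] at h
    have h := congrArg Fin.val (congrArg Prod.fst h)
    simp only [val_finRotate_symm] at h
    split_ifs at h <;> omega
  · rw [family1_adj_zero, family1_adj_one_true] at h
    have h := congrArg Fin.val (congrArg Prod.fst h)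
    simp only [val_finRotate] at h
    split_ifs at h <;> omega

theorem family1_isSpanningTree (hn : 2 ≤ n) : (family1 n).IsSpanningTree (family1Tree n) := by
  refine ⟨fun d => inv_mem_family1Tree, ?_⟩
  let H : SimpleGraph (family1 n).Flag :=
    { Adj := fun x y => ∃ d ∈ family1Tree n, d.init = x ∧ d.final = y
      symm := ⟨by
        rintro _ _ ⟨d, hd, rfl, rfl⟩
        exact ⟨d.inv, inv_mem_family1Tree hd, rfl, (family1 n).adj_adj d.2 d.1⟩⟩
      loopless := ⟨by
        rintro _ ⟨d, hd, rfl, h⟩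
        have := index_final_of_mem_family1Tree hd
        rw [h] at this
        omega⟩ }
  have h0 : 0 < n := by omega
  have hadj : ∀ {x : (family1 n).Flag} {i}, (x, i) ∈ family1Tree n →
      H.Adj x ((family1 n).adj i x) := fun h => ⟨_, h, rfl, rfl⟩
  have reach : ∀ (k : ℕ) (hk : k < n) (b : Bool), H.Reachable (⟨0, h0⟩, false) (⟨k, hk⟩, b) := by
    have flip : ∀ k : Fin n, H.Reachable (⟨0, h0⟩, false) (k, false) →
        ∀ b, H.Reachable (⟨0, h0⟩, false) (k, b) := by
      rintro k h (_ | _)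
      · exact h
      · exact h.trans (hadj (x := (k, false)) (i := 0) (by simp [family1Tree])).reachable
    intro k
    induction k with
    | zero => exact fun _ => flip _ (SimpleGraph.Reachable.refl _)
    | succ k ih =>
      intro hk
      refine flip _ ?_
      have h := (ih (by omega) true).trans
        (hadj (x := (⟨k, by omega⟩, true)) (i := 1) (by simp [family1Tree]; omega)).reachable
      rwa [family1_adj_one_true, finRotate_mk_of_lt hk] at h
  have hconn : H.Connected := by
    have : Nonempty (family1 n).Flag := ⟨(⟨0, h0⟩, false)⟩
    exact ⟨fun x y => (reach x.1 x.1.2 x.2).symm.trans (reach y.1 y.1.2 y.2)⟩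
  refine ⟨H, hconn.isTree_of_consecutive family1Index family1Index_injective ?_,
    fun d hd => ⟨d, hd, rfl, rfl⟩, ?_⟩
  · rintro _ _ ⟨d, hd, rfl, rfl⟩
    exact index_final_of_mem_family1Tree hd
  · rintro _ _ ⟨d, hd, rfl, rfl⟩
    refine ⟨d, ⟨hd, rfl, rfl⟩, ?_⟩
    rintro e ⟨he, h1, h2⟩
    obtain ⟨x, i⟩ := d
    obtain ⟨y, j⟩ := e
    obtain rfl : y = x := h1
    -- Tree darts have colour 0 or 1, and these colours are never parallel, so the two ends
    -- determine the dart.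
    have h := family1_adj_zero_ne_adj_one hn y
    have hi := hd.1
    have hj := he.1
    simp only [Dart.final] at h2
    fin_cases i <;> fin_cases j <;> simp at hi hj ⊢
    · exact h h2.symm
    · exact h h2

/-- All generators sit on colour 2, off the tree. Family 1 has no semi-edges, so the order condition
is vacuous; the only parallel darts have colours 0 and 2, separated by `α k ≠ 1`. -/
theorem family1Voltage_isVoltagePremaniplex {G : Type v} [Group G] (hn : 2 ≤ n) (α : Fin n → G)
    (hα : ∀ k, α k * α k = 1) (hα1 : ∀ k, α k ≠ 1)
    (hgen : Subgroup.closure (Set.range α) = ⊤) :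
    (family1Voltage α hα).IsVoltagePremaniplex := by
  refine ⟨family1_isPremaniplex (by omega), ⟨family1Tree n, family1_isSpanningTree hn, ?_, ?_⟩,
    ?_, ?_, ?_⟩
  · rintro d ⟨hd, -⟩
    simp [family1Voltage, hd]
  · rw [eq_top_iff, ← hgen]
    refine Subgroup.closure_mono ?_
    rintro _ ⟨k, rfl⟩
    exact ⟨((k, false), 2), fun h => h.1 rfl, by simp [family1Voltage]⟩
  · rintro ⟨⟨k, b⟩, i⟩ h
    have h := congrArg (fun d => d.1.2) h
    fin_cases i <;> cases b <;> simp [Dart.inv, family1, polygon] at h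
  · rintro ⟨x, i⟩ ⟨y, j⟩ hne hi hf
    obtain rfl : x = y := hi
    have h := family1_adj_zero_ne_adj_one hn x
    simp only [Dart.final] at hf
    fin_cases i <;> fin_cases j <;> simp [family1Voltage] at hne ⊢
    · exact (h hf).elim
    · exact (hα1 _).symm
    · exact (h hf.symm).elim
    · exact (hα1 _).symm
    · exact hα1 _
    · exact hα1 _
  · rintro i j hij ⟨k, b⟩
    fin_cases i <;> fin_cases j <;> simp at hij <;>
      simp [Voltage.path, family1Voltage, family1_adj_zero, family1_adj_two, hα]

theorem Joined.eq_of_forall_notMem {M : ColoredGraph.{u} n} {S : Set (Fin n)} {x y : M.Flag}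
    (h : M.Joined S x y) (hS : ∀ i, i ∉ S) : x = y :=
  h.induction (p := fun y => x = y) rfl fun i hi => (hS i hi).elim

/-! ### Regular maniplexes and their automorphism groups -/

/-- The bridge between voltages and flags: left multiplication by ρ_i acts on gΦ as the monodromy
r_i. -/
theorem rho_mul_apply (M : ColoredGraph.{u} n) (h : M.IsRegular) (Φ : M.Flag) (i : Fin n)
    (g : M.Aut) : (M.rho h Φ i * g).toEquiv Φ = M.adj i (g.toEquiv Φ) := by
  rw [Aut.mul_apply, rho_apply, g.map_adj]

theorem IsConnected.aut_induction {M : ColoredGraph.{u} n} (hM : M.IsConnected)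
    (h : M.IsRegular) (Φ : M.Flag) {p : M.Aut → Prop} (h1 : p 1)
    (hmul : ∀ i g, p g → p (M.rho h Φ i * g)) (g : M.Aut) : p g := by
  -- Induction along a path from Φ to gΦ; since the action is free, each flag on it corresponds to a
  -- single automorphism.
  have key : ∀ f : M.Aut, f.toEquiv Φ = g.toEquiv Φ → p f := by
    refine (hM.2 Φ (g.toEquiv Φ)).induction (p := fun y => ∀ f : M.Aut, f.toEquiv Φ = y → p f)
      ?_ ?_
    · intro f hf
      rwa [Aut.ext_of_apply_eq hM (g := 1) (x := Φ) hf]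
    · intro i _ z hz f hf
      have h2 := hz (M.rho h Φ i * f) (by rw [rho_mul_apply, hf, M.adj_adj])
      have h3 := hmul i _ h2
      rwa [← mul_assoc, rho_mul_self M hM, one_mul] at h3
  exact key g rfl

theorem IsConnected.closure_rho {M : ColoredGraph.{u} n} (hM : M.IsConnected)
    (h : M.IsRegular) (Φ : M.Flag) : Subgroup.closure (Set.range (M.rho h Φ)) = ⊤ := by
  refine eq_top_iff.2 fun g _ => ?_
  refine hM.aut_induction h Φ (p := fun g => g ∈ Subgroup.closure (Set.range (M.rho h Φ)))
    (one_mem _) (fun i g hg => mul_mem (Subgroup.subset_closure ⟨i, rfl⟩) hg) g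

theorem rho_ne_one {M : ColoredGraph.{u} n} (hM : M.IsManiplex) (h : M.IsRegular) (Φ : M.Flag)
    (i : Fin n) : M.rho h Φ i ≠ 1 := by
  intro h1
  have h2 := M.rho_apply h Φ i
  rw [h1, Aut.one_apply] at h2
  exact hM.2.2.1 i Φ h2.symm

theorem IsConnected.eval_injective {M : ColoredGraph.{u} n} (hM : M.IsConnected) (Φ : M.Flag) :
    Function.Injective fun g : M.Aut => g.toEquiv Φ :=
  fun _ _ hfg => Aut.ext_of_apply_eq hM hfg

theorem IsManiplex.finite_aut {M : ColoredGraph.{u} n} (hM : M.IsManiplex) :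
    Finite M.Aut := by
  have := hM.2.1
  obtain ⟨⟨x⟩, -⟩ := hM.1.1
  exact Finite.of_injective _ (hM.1.1.eval_injective x)

/-! ### Initial segments of Petrie polygons -/

/-- The monodromy `r_{i-1} ⋯ r_1 r_0`. -/
def petriePrefix (M : ColoredGraph.{u} n) (i : ℕ) : Equiv.Perm M.Flag :=
  (((List.finRange n).take i).reverse.map M.mon).prod

theorem petriePrefix_zero (M : ColoredGraph.{u} n) (x : M.Flag) : M.petriePrefix 0 x = x := by
  simp [petriePrefix]

theorem petriePrefix_succ (M : ColoredGraph.{u} n) (i : Fin n) (x : M.Flag) :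
    M.petriePrefix (i + 1) x = M.adj i (M.petriePrefix i x) := by
  simp [petriePrefix, List.take_add_one, mon]

theorem petriePrefix_self (M : ColoredGraph.{u} n) (x : M.Flag) :
    M.petriePrefix n x = M.petrieMon x := by
  rw [petriePrefix, petrieMon, List.take_of_length_le (by simp)]

theorem joined_petriePrefix (M : ColoredGraph.{u} n) (x : M.Flag) {i k : ℕ} (hik : i ≤ k)
    (hk : k ≤ n) : M.Joined {j | i ≤ (j : ℕ)} (M.petriePrefix i x) (M.petriePrefix k x) := by
  induction k, hik using Nat.le_induction with
  | base => exact Relation.ReflTransGen.refl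
  | succ k hik ih =>
    have h := (ih (by omega)).adj (i := ⟨k, by omega⟩) hik
    rwa [← M.petriePrefix_succ ⟨k, by omega⟩ x] at h

theorem petrieMon_mem_petriePolygon {M : ColoredGraph.{u} n} {x y : M.Flag}
    (h : y ∈ M.petriePolygon x) : M.petrieMon y ∈ M.petriePolygon x := by
  obtain ⟨⟨_, k, rfl⟩, rfl⟩ := h
  refine ⟨⟨M.petrieMon ^ (1 + k), 1 + k, rfl⟩, ?_⟩
  simp only [Subgroup.smul_def, Equiv.Perm.smul_def]
  rw [zpow_add, zpow_one, Equiv.Perm.mul_apply]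

theorem petrieMon_symm_mem_petriePolygon {M : ColoredGraph.{u} n} {x y : M.Flag}
    (h : y ∈ M.petriePolygon x) : M.petrieMon.symm y ∈ M.petriePolygon x := by
  obtain ⟨⟨_, k, rfl⟩, rfl⟩ := h
  refine ⟨⟨M.petrieMon ^ (-1 + k), -1 + k, rfl⟩, ?_⟩
  simp only [Subgroup.smul_def, Equiv.Perm.smul_def]
  rw [zpow_add, zpow_neg_one, Equiv.Perm.mul_apply]
  rfl

theorem self_mem_petriePolygon (M : ColoredGraph.{u} n) (x : M.Flag) : x ∈ M.petriePolygon x :=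
  MulAction.mem_orbit_self x

/-- The two flags are also joined by colour i alone, so the path intersection property would join
them by colours that are both at most i and at least i + 1. There are none, and the flags would
coincide. -/
theorem IsPolytope.not_joined_adj {M : ColoredGraph.{u} n} (hM : M.IsPolytope) (i : Fin n)
    (x : M.Flag) : ¬ M.Joined {j | (i : ℕ) + 1 ≤ j} (M.adj i x) x := by
  intro h
  refine hM.1.2.2.1 i x ?_
  by_cases hi : (i : ℕ) + 1 < n
  · have h1 : M.Joined {j | j ≤ i} (M.adj i x) x :=
      Joined.symm (joined_adj M (S := {j | j ≤ i}) (le_refl i) x)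
    refine (hM.2 _ _ ⟨i + 1, hi⟩ i h1 h).eq_of_forall_notMem ?_
    rintro j ⟨hj, hj'⟩
    rw [Fin.le_def] at hj hj'
    simp only at hj
    omega
  · refine h.eq_of_forall_notMem fun j hj => ?_
    have := j.2
    simp only [Set.mem_ofPred_eq] at hj
    omega

/-- After step i only colours above i are used, so a return to the flag before that step contradicts
`not_joined_adj`. -/
theorem IsPolytope.petriePrefix_ne {M : ColoredGraph.{u} n} (hM : M.IsPolytope) {i k : ℕ}
    (hik : i < k) (hk : k ≤ n) (x : M.Flag) : M.petriePrefix i x ≠ M.petriePrefix k x := by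
  intro h
  have hj := M.joined_petriePrefix x (i := i + 1) hik hk
  rw [← h, M.petriePrefix_succ ⟨i, by omega⟩] at hj
  exact hM.not_joined_adj ⟨i, by omega⟩ _ hj

/-- Colour 0 is used only in the first step, so the vertex stays fixed from then on. -/
theorem face_zero_petriePrefix (M : ColoredGraph.{u} n) {i : ℕ} (hi : 0 < i) (hin : i ≤ n)
    (x : M.Flag) : M.face 0 (M.petriePrefix i x) = M.face 0 (M.petrieMon x) := by
  rw [← M.petriePrefix_self x]
  refine face_eq_of_joined ((M.joined_petriePrefix x hin le_rfl).mono fun j hj => ?_)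
  simp only [Set.mem_ofPred_eq] at hj ⊢
  omega

/-- Comparing vertices and using simplicity turns a coincidence into `x = petrieMon y` (for i = 0)
or `x = y` (for i > 0). Both segments then belong to the same initial flag, which `petriePrefix_ne`
excludes. -/
theorem IsPolytope.petriePrefix_ne_of_mem {M : ColoredGraph.{u} n} (hM : M.IsPolytope)
    (hPetrie : M.HasSimplePetriePolygons) {i k : ℕ} (hik : i < k) (hk : k < n) {x y z : M.Flag}
    (hx : x ∈ M.petriePolygon z) (hy : y ∈ M.petriePolygon z) :
    M.petriePrefix i x ≠ M.petriePrefix k y := by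
  intro h
  have hf := congrArg (M.face 0) h
  rw [M.face_zero_petriePrefix (i := k) (by omega) hk.le] at hf
  obtain rfl | hi := Nat.eq_zero_or_pos i
  · rw [petriePrefix_zero] at hf h
    have := hPetrie z hx (petrieMon_mem_petriePolygon hy) hf
    rw [this, ← petriePrefix_self] at h
    exact hM.petriePrefix_ne hk le_rfl y h.symm
  · rw [M.face_zero_petriePrefix hi (by omega)] at hf
    have := hPetrie z (petrieMon_mem_petriePolygon hx) (petrieMon_mem_petriePolygon hy) hf
    rw [M.petrieMon.injective this] at h
    exact hM.petriePrefix_ne hik hk.le y h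

/-- In a polytope with simple Petrie polygons, the initial segments of a Petrie polygon only meet
at its beginning and at its end. -/
theorem IsPolytope.mod_eq_of_petriePrefix_eq {M : ColoredGraph.{u} n} (hM : M.IsPolytope)
    (hPetrie : M.HasSimplePetriePolygons) {i k : ℕ} (hi : i ≤ n) (hk : k ≤ n) {x y z : M.Flag}
    (hx : x ∈ M.petriePolygon z) (hy : y ∈ M.petriePolygon z)
    (h : M.petriePrefix i x = M.petriePrefix k y) : i % n = k % n := by
  -- A full segment of length n ends at the start of the next one, so length n may be replaced by 0.
  have reduce : ∀ i ≤ n, ∀ x ∈ M.petriePolygon z, 0 < n → ∃ x' ∈ M.petriePolygon z,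
      M.petriePrefix i x = M.petriePrefix (i % n) x' := by
    intro i hi x hx hn
    obtain hi | rfl := hi.lt_or_eq
    · exact ⟨x, hx, by rw [Nat.mod_eq_of_lt hi]⟩
    · exact ⟨_, petrieMon_mem_petriePolygon hx, by
        rw [Nat.mod_self, petriePrefix_zero, petriePrefix_self]⟩
  obtain rfl | hn := Nat.eq_zero_or_pos n
  · obtain rfl : i = k := by omega
    rfl
  obtain ⟨x', hx', ex⟩ := reduce i hi x hx hn
  obtain ⟨y', hy', ey⟩ := reduce k hk y hy hn
  rw [ex, ey] at h
  by_contra hne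
  obtain hlt | hlt := lt_or_gt_of_ne hne
  · exact hM.petriePrefix_ne_of_mem hPetrie hlt (Nat.mod_lt _ hn) hx' hy' h
  · exact hM.petriePrefix_ne_of_mem hPetrie hlt (Nat.mod_lt _ hn) hy' hx' h.symm

/-! ### Small ranks -/

theorem isSelfDual_of_le_one (hn : n ≤ 1) (M : ColoredGraph.{u} n) : M.IsSelfDual := by
  have : Subsingleton (Fin n) := Fin.subsingleton_iff_le_one.2 hn
  have key : ∀ (i : Fin n) (x : M.Flag), M.adj i.rev x = M.adj i x := fun i x => by
    rw [Subsingleton.elim i.rev i]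
  exact ⟨⟨Equiv.refl M.Flag, key⟩⟩

theorem petrieMon_two_apply (M : ColoredGraph.{u} 2) (x : M.Flag) :
    M.petrieMon x = M.adj 1 (M.adj 0 x) := by
  simp [petrieMon, List.finRange_succ, mon]

/-- A polygon with simple Petrie polygons has two classes of flags, interchanged by both
adjacencies; moving the flags of one class along edges of colour 0, and the others along edges of
colour 1, is a duality. -/
theorem isSelfDual_two {M : ColoredGraph.{u} 2} (hM : M.IsManiplex)
    (hPetrie : M.HasSimplePetriePolygons) : M.IsSelfDual := by
  classical
  obtain ⟨Φ⟩ := hM.1.1.1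
  set E := M.petriePolygon Φ
  have R : ∀ {x}, x ∈ E → M.adj 1 (M.adj 0 x) ∈ E := fun hx => by
    rw [← petrieMon_two_apply]
    exact petrieMon_mem_petriePolygon hx
  have R' : ∀ {x}, x ∈ E → M.adj 0 (M.adj 1 x) ∈ E := fun {x} hx => by
    have h := petrieMon_symm_mem_petriePolygon hx
    rwa [show M.petrieMon.symm x = M.adj 0 (M.adj 1 x) by
      rw [Equiv.symm_apply_eq, petrieMon_two_apply, M.adj_adj, M.adj_adj]] at h
  -- 1-adjacent flags share their vertex, so a simple Petrie polygon cannot contain both.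
  have not1 : ∀ x ∈ E, M.adj 1 x ∉ E := fun x hx hx' =>
    hM.2.2.1 1 x (hPetrie Φ hx' hx (face_eq_of_joined (joined_adj M (by simp) x)).symm)
  have not0 : ∀ x ∈ E, M.adj 0 x ∉ E := fun x hx hx' => by
    have h := R hx
    exact not1 _ hx' h
  have cover : ∀ x, x ∈ E ∨ M.adj 1 x ∈ E := by
    intro x
    refine (hM.1.1.2 Φ x).induction (p := fun x => x ∈ E ∨ M.adj 1 x ∈ E)
      (Or.inl (self_mem_petriePolygon M Φ)) ?_
    rintro i - z (hz | hz) <;> fin_cases i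
    · exact Or.inr (R hz)
    · exact Or.inr (by simpa [M.adj_adj] using hz)
    · exact Or.inl (by simpa [M.adj_adj] using R' hz)
    · exact Or.inl hz
  have mem1 : ∀ x, M.adj 1 x ∈ E ↔ x ∉ E := fun x =>
    ⟨fun h h' => not1 x h' h, fun h => (cover x).resolve_left h⟩
  have mem0 : ∀ x, M.adj 0 x ∈ E ↔ x ∉ E := fun x =>
    ⟨fun h h' => not0 x h' h, fun h => by
      have h1 := R' ((mem1 x).2 h)
      rwa [M.adj_adj] at h1⟩
  let e : M.Flag ≃ M.Flag :=
    { toFun := fun x => if x ∈ E then M.adj 0 x else M.adj 1 x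
      invFun := fun x => if x ∈ E then M.adj 1 x else M.adj 0 x
      left_inv := fun x => by by_cases hx : x ∈ E <;> simp [hx, mem0, mem1, M.adj_adj]
      right_inv := fun x => by by_cases hx : x ∈ E <;> simp [hx, mem0, mem1, M.adj_adj] }
  have key : ∀ (i : Fin 2) (x : M.Flag), e (M.adj i.rev x) = M.adj i (e x) := fun i x => by
    fin_cases i <;> by_cases hx : x ∈ E <;> simp [e, hx, mem0, mem1, M.adj_adj]
  exact ⟨⟨e, key⟩⟩

theorem IsPolytope.three_le {M : ColoredGraph.{u} n} (hM : M.IsPolytope)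
    (hPetrie : M.HasSimplePetriePolygons) (hdual : ¬ M.IsSelfDual) : 3 ≤ n := by
  by_contra hn
  obtain h | rfl : n ≤ 1 ∨ n = 2 := by omega
  · exact hdual (isSelfDual_of_le_one h M)
  · exact hdual (isSelfDual_two hM.1 hPetrie)

/-! ### Derived graphs -/

/-- Right multiplication on the voltages is an automorphism of the derived graph. -/
def Voltage.mulRight {X : ColoredGraph.{u} n} {G : Type v} [Group G] (ξ : X.Voltage G) (h : G) :
    ξ.derived.Aut where
  toEquiv := (Equiv.refl X.Flag).prodCongr (Equiv.mulRight h)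
  map_adj _ _ := Prod.ext rfl (mul_assoc _ _ _)

theorem Voltage.mulRight_apply {X : ColoredGraph.{u} n} {G : Type v} [Group G] (ξ : X.Voltage G)
    (h : G) (c : X.Flag) (g : G) : (ξ.mulRight h).toEquiv (c, g) = (c, g * h) := rfl

section

variable {G : Type v} [Group G] {α : Fin n → G} {hα : ∀ k, α k * α k = 1}

theorem derived_family1_adj_of_ne {i : Fin 3} (hi : i ≠ 2) (c : (family1 n).Flag) (g : G) :
    (family1Voltage α hα).derived.adj i (c, g) = ((family1 n).adj i c, g) := by
  simp [Voltage.derived, family1Voltage, hi]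

theorem derived_family1_adj_two (c : (family1 n).Flag) (g : G) :
    (family1Voltage α hα).derived.adj 2 (c, g) = ((family1 n).adj 2 c, α c.1 * g) := by
  simp [Voltage.derived, family1Voltage]

/-- The flags of the derived graph with the same voltage coordinate form a polygon. -/
theorem derived_family1_joined (c d : (family1 n).Flag) (g : G) :
    (family1Voltage α hα).derived.Joined {i | i ≠ 2} (c, g) (d, g) := by
  refine family1_induction (p := fun d => (family1Voltage α hα).derived.Joined {i | i ≠ 2}
    (c, g) (d, g)) (c := c) Relation.ReflTransGen.refl ?_ ?_ d
  · exact fun x hx => hx.tail (i := 0) (by simp) (derived_family1_adj_of_ne (by simp) x g)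
  · exact fun x hx => hx.tail (i := 1) (by simp) (derived_family1_adj_of_ne (by simp) x g)

theorem snd_eq_of_joined_derived_family1 {x y : (family1Voltage α hα).derived.Flag}
    (h : (family1Voltage α hα).derived.Joined {i | i ≠ 2} x y) : y.2 = x.2 := by
  refine h.induction (p := fun y : (family1Voltage α hα).derived.Flag => y.2 = x.2) rfl ?_
  rintro i hi ⟨c, g⟩ hz
  rw [derived_family1_adj_of_ne hi]
  exact hz

/-- Every vertex of the derived graph contains a flag over the first flag of the polygon. -/
theorem exists_derived_family1_joined_first (hn : 0 < n) :
    ∀ (k : ℕ) (hk : k < n) (b : Bool) (g : G), ∃ g' : G,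
      (family1Voltage α hα).derived.Joined {i | i ≠ 0} ((⟨k, hk⟩, b), g)
        ((⟨0, hn⟩, false), g') := by
  have flip : ∀ k : Fin n, (∀ g : G, ∃ g' : G, (family1Voltage α hα).derived.Joined {i | i ≠ 0}
      ((k, false), g) ((⟨0, hn⟩, false), g')) → ∀ (b : Bool) (g : G), ∃ g' : G,
      (family1Voltage α hα).derived.Joined {i | i ≠ 0} ((k, b), g)
        ((⟨0, hn⟩, false), g') := by
    rintro k h (_ | _) g
    · exact h g
    · obtain ⟨g', hg'⟩ := h (α k * g)
      exact ⟨g', Joined.trans (Joined.tail Relation.ReflTransGen.refl (i := 2) (by simp)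
        (derived_family1_adj_two (k, true) g)) hg'⟩
  intro k
  induction k with
  | zero => exact fun _ => flip _ fun g => ⟨g, Relation.ReflTransGen.refl⟩
  | succ k ih =>
    intro hk
    refine flip _ fun g => ?_
    obtain ⟨g', hg'⟩ := ih (by omega) true g
    refine ⟨g', Joined.trans (Joined.symm ?_) hg'⟩
    refine Joined.tail Relation.ReflTransGen.refl (i := 1) (by simp)
      ((derived_family1_adj_of_ne (by simp) (⟨k, by omega⟩, true) g).trans ?_)
    rw [family1_adj_one_true, finRotate_mk_of_lt hk]

/-- Right multiplications are transitive on the fibre over c, so it is enough that every i-face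
meets this fibre. -/
theorem derived_family1_isFaceTransitive_of_joined {i : ℕ} (c : (family1 n).Flag)
    (h : ∀ x : (family1Voltage α hα).derived.Flag, ∃ g : G,
      (family1Voltage α hα).derived.Joined {j | (j : ℕ) ≠ i} x (c, g)) :
    (family1Voltage α hα).derived.IsFaceTransitive i := by
  rintro _ ⟨x, rfl⟩ _ ⟨y, rfl⟩
  obtain ⟨g, hg⟩ := h x
  obtain ⟨g', hg'⟩ := h y
  refine ⟨(family1Voltage α hα).mulRight (g⁻¹ * g'), ?_⟩
  rw [face_eq_of_joined hg, face_eq_of_joined hg']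
  refine (Aut.image_face _ i _).trans (congrArg _ ?_)
  rw [Voltage.mulRight_apply, mul_inv_cancel_left]

theorem derived_family1_isFaceTransitive_zero (hn : 0 < n) :
    (family1Voltage α hα).derived.IsFaceTransitive 0 := by
  refine derived_family1_isFaceTransitive_of_joined (⟨0, hn⟩, false) fun x => ?_
  obtain ⟨g, hg⟩ := exists_derived_family1_joined_first (hα := hα) hn x.1.1 x.1.1.2 x.1.2 x.2
  exact ⟨g, hg.mono fun j hj => Fin.val_ne_of_ne hj⟩

theorem derived_family1_isFaceTransitive_two (hn : 0 < n) :
    (family1Voltage α hα).derived.IsFaceTransitive 2 := by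
  refine derived_family1_isFaceTransitive_of_joined (⟨0, hn⟩, false) fun x => ⟨x.2, ?_⟩
  exact (derived_family1_joined x.1 _ x.2).mono fun j hj => Fin.val_ne_of_ne hj

end

/-! ### The derived graph is a polyhedron -/

section

variable {P : ColoredGraph.{u} n} {hreg : P.IsRegular} {Φ : P.Flag}
  {hρ : ∀ k, P.rho hreg Φ k * P.rho hreg Φ k = 1}

/-- The number of the vertex of the polygon at a flag; the first vertex is numbered both by `0` and
by `n`. -/
def family1Vertex (c : (family1 n).Flag) : ℕ := (c.1 : ℕ) + c.2.toNat

theorem family1Vertex_le (c : (family1 n).Flag) : family1Vertex c ≤ n := by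
  have := c.1.2
  have := Bool.toNat_le c.2
  unfold family1Vertex
  omega

/-- Each vertex of the polygon lies in two flags, which are 1-adjacent; the modulus identifies the
two numbers of the first vertex. -/
theorem eq_or_eq_adj_one_of_family1Vertex {c d : (family1 n).Flag}
    (h : family1Vertex c % n = family1Vertex d % n) : d = c ∨ d = (family1 n).adj 1 c := by
  obtain ⟨k, b⟩ := c
  obtain ⟨l, b'⟩ := d
  have hk := k.2
  have hl := l.2
  have mod_succ : ∀ k : Fin n, ((k : ℕ) + 1) % n = finRotate n k := by
    intro k
    have := k.2
    rw [val_finRotate]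
    split_ifs with h
    · rw [h, Nat.mod_self]
    · exact Nat.mod_eq_of_lt (by omega)
  cases b <;> cases b' <;>
    simp only [family1Vertex, Bool.toNat_true, Bool.toNat_false, add_zero, mod_succ,
      Nat.mod_eq_of_lt hk, Nat.mod_eq_of_lt hl, Fin.val_inj] at h
  · exact Or.inl (by rw [h])
  · exact Or.inr (by rw [family1_adj_one_false, h, Equiv.symm_apply_apply])
  · exact Or.inr (by rw [family1_adj_one_true, h])
  · exact Or.inl (by rw [(finRotate n).injective h])

/-- The vertices of the derived graph correspond to Petrie polygons. -/
theorem exists_mem_petriePolygon_of_joined {x y : (family1Voltage (P.rho hreg Φ) hρ).derived.Flag}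
    {z : P.Flag} (h : (family1Voltage (P.rho hreg Φ) hρ).derived.Joined {i | i ≠ 0} x y)
    (hx : ∃ w ∈ P.petriePolygon z, x.2.toEquiv Φ = P.petriePrefix (family1Vertex x.1) w) :
    ∃ w ∈ P.petriePolygon z, y.2.toEquiv Φ = P.petriePrefix (family1Vertex y.1) w := by
  refine h.induction (p := fun y : (family1Voltage (P.rho hreg Φ) hρ).derived.Flag =>
    ∃ w ∈ P.petriePolygon z,
    y.2.toEquiv Φ = P.petriePrefix (family1Vertex y.1) w) hx ?_
  rintro i hi ⟨c, g⟩ ⟨w, hw, hg⟩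
  have h01 : i = 1 ∨ i = 2 := by
    fin_cases i
    · exact absurd rfl hi
    · exact Or.inl rfl
    · exact Or.inr rfl
  obtain rfl | rfl := h01
  · rw [derived_family1_adj_of_ne (by simp)]
    obtain ⟨k, b⟩ := c
    have hk := k.2
    cases b
    · rw [family1_adj_one_false]
      simp only [family1Vertex, Bool.toNat_false, Bool.toNat_true, add_zero] at hg ⊢
      rw [val_finRotate_symm]
      -- A colour-1 step keeps the vertex number except at the first vertex, where it switches
      -- between 0 and n. There w moves by one Petrie step to compensate.
      split_ifs with h0
      · refine ⟨_, petrieMon_symm_mem_petriePolygon hw, ?_⟩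
        rw [hg, h0, Nat.sub_add_cancel (by omega), petriePrefix_self, petriePrefix_zero,
          Equiv.apply_symm_apply]
      · exact ⟨w, hw, by rw [hg, Nat.sub_add_cancel (by omega)]⟩
    · rw [family1_adj_one_true]
      simp only [family1Vertex, Bool.toNat_false, Bool.toNat_true, add_zero] at hg ⊢
      rw [val_finRotate]
      split_ifs with h0
      · refine ⟨_, petrieMon_mem_petriePolygon hw, ?_⟩
        rw [hg, h0, petriePrefix_self, petriePrefix_zero]
      · exact ⟨w, hw, hg⟩
  -- Crossing edge k by colour 2 applies r_k to gΦ, which passes between the segments of lengths k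
  -- and k + 1 from the same w.
  · refine ⟨w, hw, ?_⟩
    rw [derived_family1_adj_two]
    obtain ⟨k, b⟩ := c
    rw [family1_adj_two]
    cases b
    · simp only [family1Vertex, Bool.toNat_false, Bool.toNat_true, add_zero, Bool.not_false]
        at hg ⊢
      rw [rho_mul_apply, hg, petriePrefix_succ]
    · simp only [family1Vertex, Bool.toNat_false, Bool.toNat_true, add_zero, Bool.not_true]
        at hg ⊢
      rw [rho_mul_apply, hg, petriePrefix_succ, P.adj_adj]

/-- Equal second coordinates give the same flag of P at two positions of one Petrie polygon; these
must agree modulo n, so the two polygon flags lie at the same vertex. -/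
theorem eq_or_eq_adj_one_of_joined (hP : P.IsPolytope) (hPetrie : P.HasSimplePetriePolygons)
    {x y : (family1Voltage (P.rho hreg Φ) hρ).derived.Flag}
    (h : (family1Voltage (P.rho hreg Φ) hρ).derived.Joined {i | i ≠ 0} x y) (h2 : y.2 = x.2) :
    y = x ∨ y = (family1Voltage (P.rho hreg Φ) hρ).derived.adj 1 x := by
  obtain ⟨w, hw⟩ := (P.petriePrefix (family1Vertex x.1)).surjective (x.2.toEquiv Φ)
  obtain ⟨w', hw', h'⟩ := exists_mem_petriePolygon_of_joined (z := w) h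
    ⟨w, P.self_mem_petriePolygon w, hw.symm⟩
  rw [h2, ← hw] at h'
  obtain ⟨c, g⟩ := x
  obtain ⟨d, g'⟩ := y
  obtain rfl : g' = g := h2
  rw [derived_family1_adj_of_ne (by simp)]
  obtain h | h := eq_or_eq_adj_one_of_family1Vertex (hP.mod_eq_of_petriePrefix_eq hPetrie
    (family1Vertex_le c) (family1Vertex_le d) (P.self_mem_petriePolygon w) hw' h')
  · exact Or.inl (by rw [h])
  · exact Or.inr (by rw [h])

/-- Colour 2 at edge k leads from facet g to facet ρ_k g, and the ρ_k generate the group. -/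
theorem derived_family1_isConnected (hn : 0 < n) (hP : P.IsConnected) :
    (family1Voltage (P.rho hreg Φ) hρ).derived.IsConnected := by
  set D := (family1Voltage (P.rho hreg Φ) hρ).derived
  have facet : ∀ (c d : (family1 n).Flag) (g : P.Aut), D.Joined Set.univ (c, g) (d, g) :=
    fun c d g => (derived_family1_joined c d g).mono (Set.subset_univ _)
  have key : ∀ g : P.Aut, D.Joined Set.univ ((⟨0, hn⟩, false), 1) ((⟨0, hn⟩, false), g) := by
    refine hP.aut_induction hreg Φ Relation.ReflTransGen.refl fun k g hg => ?_
    exact ((hg.trans (facet _ (k, false) g)).tail (i := 2) (Set.mem_univ _)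
      (derived_family1_adj_two (k, false) g)).trans (facet _ _ _)
  exact ⟨⟨((⟨0, hn⟩, false), 1)⟩, fun x y =>
    ((facet x.1 _ x.2).trans (key x.2).symm).trans ((key y.2).trans (facet _ y.1 y.2))⟩

theorem derived_family1_isManiplex (hn : 2 ≤ n) (hP : P.IsManiplex) :
    (family1Voltage (P.rho hreg Φ) hρ).derived.IsManiplex := by
  have hfin := hP.finite_aut
  have adj_ne : ∀ i (c : (family1 n).Flag), (family1 n).adj i c ≠ c := by
    rintro i ⟨k, b⟩ h
    have h := congrArg Prod.snd h
    fin_cases i <;> cases b <;> simp [family1, polygon] at h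
  refine ⟨⟨derived_family1_isConnected (by omega) hP.1.1, ?_⟩, ?_, ?_, ?_⟩
  · rintro i j hij ⟨⟨k, b⟩, g⟩
    fin_cases i <;> fin_cases j <;> simp at hij
    · simp [Voltage.derived, family1Voltage, family1, polygon, ← mul_assoc, hρ]
    · simp [Voltage.derived, family1Voltage, family1, polygon, ← mul_assoc, hρ]
  · change Finite ((Fin n × Bool) × P.Aut)
    infer_instance
  · rintro i ⟨c, g⟩ h
    exact adj_ne i c (congrArg Prod.fst h)
  · have h01 := family1_adj_zero_ne_adj_one (n := n) hn
    rintro i j ⟨c, g⟩ hij h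
    have h1 : (family1 n).adj i c = (family1 n).adj j c := congrArg Prod.fst h
    have h2 : ∀ g : P.Aut, P.rho hreg Φ c.1 * g ≠ g := fun g h =>
      rho_ne_one hP hreg Φ c.1 (by simpa using h)
    fin_cases i <;> fin_cases j <;> simp at hij
    · exact h01 c h1
    · exact h2 g (by simpa [Voltage.derived, family1Voltage] using (congrArg Prod.snd h).symm)
    · exact h01 c h1.symm
    · exact h01 c h1.symm
    · exact h2 g (by simpa [Voltage.derived, family1Voltage] using congrArg Prod.snd h)
    · exact h01 c h1

/-- The cases k = 0 and m = 2 are trivial. Otherwise one path avoids colour 2 and the other avoids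
colour 0, so the end is x or its 1-adjacent flag; when colour 1 is not allowed in the intersection,
simplicity of the graph leaves only x. -/
theorem derived_family1_isPolytope (hn : 2 ≤ n) (hP : P.IsPolytope)
    (hPetrie : P.HasSimplePetriePolygons) :
    (family1Voltage (P.rho hreg Φ) hρ).derived.IsPolytope := by
  have hD := derived_family1_isManiplex (hρ := hρ) hn hP.1
  refine ⟨hD, ?_⟩
  set D := (family1Voltage (P.rho hreg Φ) hρ).derived
  have single : ∀ {S : Set (Fin 3)} {i : Fin 3} {x y : D.Flag}, (∀ j ∈ S, j = i) →
      D.Joined S x y → y = x ∨ y = D.adj i x := by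
    intro S i x y hS h
    refine h.induction (p := fun y => y = x ∨ y = D.adj i x) (Or.inl rfl) ?_
    rintro j hj z (rfl | rfl) <;> rw [hS j hj]
    · exact Or.inr rfl
    · exact Or.inl (D.adj_adj i x)
  have facet : ∀ {S : Set (Fin 3)} {x y : D.Flag}, (∀ j ∈ S, j ≠ 2) → D.Joined S x y →
      y.2 = x.2 := fun hS h => snd_eq_of_joined_derived_family1 (h.mono hS)
  have vertex : ∀ {S : Set (Fin 3)} {x y : D.Flag}, (∀ j ∈ S, j ≠ 0) → D.Joined S x y →
      y.2 = x.2 → y = x ∨ y = D.adj 1 x :=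
    fun hS h => eq_or_eq_adj_one_of_joined hP hPetrie (h.mono hS)
  intro x y k m h1 h2
  have hk : k = 0 ∨ k = 1 ∨ k = 2 := by omega
  have hm : m = 0 ∨ m = 1 ∨ m = 2 := by omega
  obtain rfl | hk := hk
  · exact h1.mono fun j hj => And.intro (Fin.zero_le j) hj
  obtain hm | hm | rfl := hm
  · subst hm
    have e := single (i := 0) (by simp) h1
    have g := facet (by rintro j hj rfl; simp at hj) h1
    obtain rfl | e := e
    · exact Relation.ReflTransGen.refl
    · obtain rfl | e' := vertex (by rintro j hj rfl; simp at hj; omega) h2 g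
      · exact Relation.ReflTransGen.refl
      · exact absurd (e.symm.trans e') (hD.2.2.2 0 1 x (by simp))
  · subst hm
    have g := facet (by rintro j hj rfl; simp at hj) h1
    obtain rfl | e := vertex (by rintro j hj rfl; simp at hj; omega) h2 g
    · exact Relation.ReflTransGen.refl
    · obtain rfl | rfl := hk
      · rw [e]
        exact joined_adj D (by simp) x
      · obtain rfl | e' := single (i := 2) (fun j hj => by simp at hj; omega) h2
        · exact Relation.ReflTransGen.refl
        · exact absurd (e.symm.trans e') (hD.2.2.2 1 2 x (by simp))
  · exact h2.mono fun j hj => And.intro hj (Fin.le_last j)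

end

/-! ### Rigidity -/

theorem finRotate_rev (k : Fin n) : (finRotate n k).rev = (finRotate n).symm k.rev := by
  have := k.2
  rw [Fin.ext_iff, val_finRotate_symm, Fin.val_rev, Fin.val_rev, val_finRotate]
  split_ifs <;> omega

/-- A symmetry of the polygon is trivial, or reverses the numbering of the edges, or maps the first
and the last edge to two edges with consecutive numbers. -/
theorem family1_symmetry_cases (hn : 0 < n) {δ : (family1 n).Flag → (family1 n).Flag}
    (h0 : ∀ c, δ ((family1 n).adj 0 c) = (family1 n).adj 0 (δ c))
    (h1 : ∀ c, δ ((family1 n).adj 1 c) = (family1 n).adj 1 (δ c)) :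
    (∀ c, δ c = c) ∨ (∀ c, (δ c).1 = Fin.rev c.1) ∨
      ((δ (⟨0, hn⟩, false)).1 : ℕ) = (δ (⟨n - 1, by omega⟩, true)).1 + 1 ∨
      ((δ (⟨n - 1, by omega⟩, true)).1 : ℕ) = (δ (⟨0, hn⟩, false)).1 + 1 := by
  -- The flag at the end `true` of edge n - 1 is 1-adjacent to the first flag, so the image of the
  -- first flag decides every case.
  have hlast := h1 (⟨0, hn⟩, false)
  rw [family1_adj_one_false, show (finRotate n).symm ⟨0, hn⟩ = ⟨n - 1, by omega⟩ by
    rw [Fin.ext_iff, val_finRotate_symm]; simp] at hlast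
  rw [hlast]
  rcases hc : δ (⟨0, hn⟩, false) with ⟨⟨a, ha⟩, b⟩
  cases b
  · obtain rfl | ha0 := Nat.eq_zero_or_pos a
    · left
      refine family1_induction hc ?_ ?_
      · intro x hx
        rw [h0, hx]
      · intro x hx
        rw [h1, hx]
    · right; right; left
      rw [family1_adj_one_false]
      simp only [val_finRotate_symm]
      split_ifs <;> omega
  · by_cases ha1 : a + 1 = n
    · right; left
      have key : ∀ c : (family1 n).Flag, δ c = (Fin.rev c.1, !c.2) := by
        refine family1_induction (c := (⟨0, hn⟩, false)) ?_ ?_ ?_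
        · rw [hc]
          refine Prod.ext (Fin.ext ?_) rfl
          simp only [Fin.val_rev]
          omega
        · intro x hx
          rw [h0, hx]
          rfl
        · intro x hx
          rw [h1, hx]
          obtain ⟨k, _ | _⟩ := x
          · rw [family1_adj_one_false]
            refine Prod.ext ?_ rfl
            change finRotate n k.rev = Fin.rev ((finRotate n).symm k)
            rw [← Equiv.eq_symm_apply, ← finRotate_rev, Equiv.apply_symm_apply]
          · rw [family1_adj_one_true]
            refine Prod.ext ?_ rfl
            exact (finRotate_rev k).symm
      intro c
      rw [key]
    · right; right; right
      rw [family1_adj_one_true]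
      simp only [val_finRotate]
      split_ifs; omega

theorem isDegenerate_of_adj {M : ColoredGraph.{u} n} {i j : Fin n} {x : M.Flag}
    (hij : (i : ℕ) = j + 1 ∨ (j : ℕ) = i + 1)
    (h : M.adj j (M.adj i (M.adj j (M.adj i x))) = x) : M.IsDegenerate := by
  obtain hij | hij := hij
  · exact ⟨j, i, hij, x, by simpa [pow_two, mon] using h⟩
  · refine ⟨i, j, hij, x, ?_⟩
    conv_lhs => rw [← h]
    simp [pow_two, mon, M.adj_adj]

/-- Automorphisms of the derived graph preserve the flags of the base graph. -/
theorem derived_family1_aut_apply_fst {P : ColoredGraph.{u} n} {hreg : P.IsRegular} {Φ : P.Flag}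
    {hρ : ∀ k, P.rho hreg Φ k * P.rho hreg Φ k = 1} (hn : 3 ≤ n) (hP : P.IsManiplex)
    (hdeg : ¬ P.IsDegenerate) (hdual : ¬ P.IsSelfDual)
    (τ : (family1Voltage (P.rho hreg Φ) hρ).derived.Aut)
    (x : (family1Voltage (P.rho hreg Φ) hρ).derived.Flag) : (τ.toEquiv x).1 = x.1 := by
  have hn0 : 0 < n := by omega
  let F : (family1 n).Flag → P.Aut → (family1Voltage (P.rho hreg Φ) hρ).derived.Flag := fun c g => τ.toEquiv (c, g)
  have F_adj : ∀ (i : Fin 3), i ≠ 2 → ∀ c g,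
      F ((family1 n).adj i c) g = ((family1 n).adj i (F c g).1, (F c g).2) := by
    intro i hi c g
    exact ((congrArg τ.toEquiv (derived_family1_adj_of_ne hi c g).symm).trans
      (τ.map_adj i (c, g))).trans (derived_family1_adj_of_ne hi (F c g).1 (F c g).2)
  have F_two : ∀ c g, F ((family1 n).adj 2 c) (P.rho hreg Φ c.1 * g) =
      ((family1 n).adj 2 (F c g).1, P.rho hreg Φ (F c g).1.1 * (F c g).2) := by
    intro c g
    exact ((congrArg τ.toEquiv (derived_family1_adj_two c g).symm).trans
      (τ.map_adj 2 (c, g))).trans (derived_family1_adj_two (F c g).1 (F c g).2)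
  let c0 : (family1 n).Flag := (⟨0, hn0⟩, false)
  let t : P.Aut → P.Aut := fun g => (F c0 g).2
  -- Facets go to facets: facet g is mapped to facet `t g`.
  have F_snd : ∀ g c, (F c g).2 = t g := by
    intro g
    refine family1_induction (c := c0) rfl ?_ ?_ <;> intro x hx
    · rw [F_adj 0 (by simp)]
      exact hx
    · rw [F_adj 1 (by simp)]
      exact hx
  let δ : (family1 n).Flag → (family1 n).Flag := fun c => (F c 1).1
  -- The polygon symmetry is the same on all facets: colours 0 and 2 agree in the base graph, so
  -- crossing a colour-2 edge preserves its value at one flag, hence everywhere.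
  have F_fst : ∀ g c, (F c g).1 = δ c := by
    refine hP.1.1.aut_induction hreg Φ (fun _ => rfl) ?_
    intro k g hg
    let c : (family1 n).Flag := (k, false)
    refine family1_induction (c := (family1 n).adj 2 c) ?_ ?_ ?_
    · exact (congrArg Prod.fst (F_two c g)).trans ((congrArg ((family1 n).adj 2) (hg c)).trans
        (congrArg Prod.fst (F_adj 0 (by simp) c 1)).symm)
    · intro x hx
      rw [F_adj 0 (by simp), hx]
      exact (congrArg Prod.fst (F_adj 0 (by simp) x 1)).symm
    · intro x hx
      rw [F_adj 1 (by simp), hx]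
      exact (congrArg Prod.fst (F_adj 1 (by simp) x 1)).symm
  have t_mul : ∀ (c : (family1 n).Flag) g,
      t (P.rho hreg Φ c.1 * g) = P.rho hreg Φ (δ c).1 * t g := by
    intro c g
    have h := congrArg Prod.snd (F_two c g)
    rw [F_snd] at h
    rw [h, F_fst, F_snd]
  have t_apply : ∀ (c : (family1 n).Flag) g, (t (P.rho hreg Φ c.1 * g)).toEquiv Φ =
      P.adj (δ c).1 ((t g).toEquiv Φ) := by
    intro c g
    rw [t_mul, rho_mul_apply]
  have cases := family1_symmetry_cases hn0 (δ := δ)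
    (fun c => congrArg Prod.fst (F_adj 0 (by simp) c 1))
    (fun c => congrArg Prod.fst (F_adj 1 (by simp) c 1))
  obtain h | h | h := cases
  · exact (F_fst x.2 x.1).trans (h x.1)
  · exfalso
    have := hP.finite_aut
    have t_inj : Function.Injective t := by
      intro g g' hg
      have : F c0 g = F c0 g' := Prod.ext ((F_fst g c0).trans (F_fst g' c0).symm) hg
      exact congrArg Prod.snd (τ.toEquiv.injective this)
    -- `E` is the identification g ↦ gΦ; transporting `t` along it gives a permutation of the flags
    -- of P that exchanges colours i and n-1-i.
    let T := Equiv.ofBijective t t_inj.bijective_of_finite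
    let E := Equiv.ofBijective (fun g : P.Aut => g.toEquiv Φ)
      ⟨hP.1.1.eval_injective Φ, hreg Φ⟩
    have key : ∀ (i : Fin n) (y : P.Flag), (E.symm.trans (T.trans E)) (P.adj i.rev y) =
        P.adj i ((E.symm.trans (T.trans E)) y) := by
      intro i y
      obtain ⟨g, rfl⟩ := E.surjective y
      have e : P.adj i.rev (E g) = E (P.rho hreg Φ i.rev * g) :=
        (P.rho_mul_apply hreg Φ i.rev g).symm
      rw [e]
      simp only [Equiv.trans_apply, Equiv.symm_apply_apply]
      refine (t_apply (i.rev, false) g).trans ?_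
      rw [h (i.rev, false)]
      simp only [Fin.rev_rev]
      rfl
    exact hdual ⟨⟨E.symm.trans (T.trans E), key⟩⟩
  · exfalso
    let c1 : (family1 n).Flag := (⟨n - 1, by omega⟩, true)
    -- `t` carries the relation (ρ_{n-1} ρ_0)² = 1, valid since n - 1 > 1, to a closed alternating
    -- walk at t(1)Φ in two consecutive colours.
    refine hdeg (isDegenerate_of_adj (i := (δ c0).1) (j := (δ c1).1) h (x := (t 1).toEquiv Φ) ?_)
    rw [← t_apply c0, ← t_apply c1, ← t_apply c0, ← t_apply c1]
    refine congrArg (fun g => (t g).toEquiv Φ) (hP.1.1.eval_injective Φ ?_)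
    have apply_four : ∀ (i j : Fin n) (g : P.Aut),
        (P.rho hreg Φ i * (P.rho hreg Φ j * (P.rho hreg Φ i * (P.rho hreg Φ j * g)))).toEquiv Φ =
          P.adj i (P.adj j (P.adj i (P.adj j (g.toEquiv Φ)))) := fun i j g => by
      simp only [rho_mul_apply]
    refine (apply_four _ _ _).trans (hP.1.2 _ _ ?_ _)
    rw [lt_abs]
    right
    change 1 < -(((0 : ℕ) : ℤ) - ((n - 1 : ℕ) : ℤ))
    omega

/-! ### The theorem -/

/-- Flag orbits are exactly the fibres of the first projection: rigidity keeps each fibre invariant,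
and right multiplication is transitive on it. -/
theorem derived_family1_symmetryTypeGraph {P : ColoredGraph.{u} n} {hreg : P.IsRegular}
    {Φ : P.Flag} {hρ : ∀ k, P.rho hreg Φ k * P.rho hreg Φ k = 1} (hn : 3 ≤ n) (hP : P.IsManiplex)
    (hdeg : ¬ P.IsDegenerate) (hdual : ¬ P.IsSelfDual) :
    Nonempty (Iso (family1Voltage (P.rho hreg Φ) hρ).derived.symmetryTypeGraph (family1 n)) := by
  set D := (family1Voltage (P.rho hreg Φ) hρ).derived
  let f : D.FlagOrbit → (family1 n).Flag := Quotient.lift (fun x => x.1) (by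
    rintro x _ ⟨τ, rfl⟩
    exact (derived_family1_aut_apply_fst hn hP hdeg hdual τ x).symm)
  have hf : Function.Bijective f := by
    constructor
    · rintro ⟨⟨c, g⟩⟩ ⟨⟨c', g'⟩⟩ (h : c = c')
      subst h
      refine Quotient.sound ⟨(family1Voltage (P.rho hreg Φ) hρ).mulRight (g⁻¹ * g'), ?_⟩
      rw [Voltage.mulRight_apply, mul_inv_cancel_left]
    · exact fun c => ⟨Quotient.mk _ (c, 1), rfl⟩
  refine ⟨⟨Equiv.ofBijective f hf, ?_⟩⟩
  rintro i ⟨x⟩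
  rfl

end ColoredGraph

theorem mainTheorem1 (n : ℕ) (P : ColoredGraph.{u} n) (hP : P.IsPolytope) (hreg : P.IsRegular)
    (hPetrie : P.HasSimplePetriePolygons) (hdeg : ¬ P.IsDegenerate) (hdual : ¬ P.IsSelfDual)
    (Φ : P.Flag) :
    let ξ : (ColoredGraph.family1 n).Voltage P.Aut :=
      ColoredGraph.family1Voltage (P.rho hreg Φ) (P.rho_mul_self hP.1.1.1 hreg Φ)
    ξ.IsVoltagePremaniplex ∧
      ξ.derived.IsPolytope ∧
      Nonempty (ColoredGraph.Iso ξ.derived.symmetryTypeGraph (ColoredGraph.family1 n)) ∧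
      ξ.derived.IsFaceTransitive 0 ∧
      ξ.derived.IsFaceTransitive 2 ∧
      ξ.derived.HasTrivialFacetStabilizers ∧
      Nat.card ξ.derived.FlagOrbit = 2 * n := by
  intro ξ
  have hn := hP.three_le hPetrie hdual
  have hpoly : ξ.derived.IsPolytope := ColoredGraph.derived_family1_isPolytope (by omega) hP hPetrie
  have hiso := ColoredGraph.derived_family1_symmetryTypeGraph (Φ := Φ)
    (hρ := P.rho_mul_self hP.1.1.1 hreg Φ) hn hP.1 hdeg hdual
  refine ⟨ColoredGraph.family1Voltage_isVoltagePremaniplex (by omega) _ _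
      (ColoredGraph.rho_ne_one hP.1 hreg Φ) (hP.1.1.1.closure_rho hreg Φ), hpoly, hiso,
    ColoredGraph.derived_family1_isFaceTransitive_zero (by omega),
    ColoredGraph.derived_family1_isFaceTransitive_two (by omega), ?_, ?_⟩
  -- Preserving the facet fixes the second coordinate of x, rigidity fixes the first, and
  -- automorphisms act freely.
  · rintro _ ⟨x, rfl⟩ τ hτ
    have h1 : τ.toEquiv x ∈ ξ.derived.face (3 - 1) x := by
      rw [← hτ]
      exact ⟨x, Relation.ReflTransGen.refl, rfl⟩
    have h2 := ColoredGraph.snd_eq_of_joined_derived_family1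
      (ColoredGraph.Joined.mono (T := {i | i ≠ 2}) (fun j hj => Fin.ne_of_val_ne hj) h1)
    have h3 := ColoredGraph.derived_family1_aut_apply_fst hn hP.1 hdeg hdual τ x
    exact ColoredGraph.Aut.ext_of_apply_eq hpoly.1.1.1 (x := x) (Prod.ext h3 h2)
  · obtain ⟨e⟩ := hiso
    refine (Nat.card_congr e.toEquiv).trans ?_
    change Nat.card (Fin n × Bool) = 2 * n
    simp [mul_comm]
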